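/- Let $\mathcal X$ be a measurable space and let $\mathcal Z$ be a topological space equipped with a $\sigma$-algebra containing its Borel sets. Let $\mathcal H_{\mathcal X}$ be a separable real reproducing kernel Hilbert space (RKHS) of functions on $\mathcal X$ with kernel $k_{\mathcal X}$, where each $k_{\mathcal X}(x,\cdot)$ is measurable. Let $k_{\mathcal Z}:\mathcal Z\times\mathcal Z\to\mathbb R$ be a symmetric positive semidefinite kernel, and let $\mathcal G$ be the RKHS of functions $\mathcal Z\to\mathcal H_{\mathcal X}$ with operator-valued kernel $l(z,z')=k_{\mathcal Z}(z,z')\,\mathrm{Id}$, assumed separable. Suppose that 1. there are $B_{\mathcal X},B_{\mathcal Z}>0$ with $k_{\mathcal X}(x,x)\le B_{\mathcal X}^2$ and $k_{\mathcal Z}(z,z)\le B_{\mathcal Z}^2$ for all $x\in\mathcal X$, $z\in\mathcal Z$; 2. $l$ is $\mathcal C_0$-universal, i.e. every $F\in\mathcal G$ is continuous and vanishes at infinity, and $\mathcal G$ is dense in $L^2(\mathcal Z,\mu;\mathcal H_{\mathcal X})$ for every probability measure $\mu$ on $\mathcal Z$; 3. $\lambda_n>0$, $\lambda_n\to0$ and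 $\sqrt n\,\lambda_n\to\infty$. For a probability measure $P_{XZ}$ on $\mathcal X\times\mathcal Z$ (the law of $(X,Z)$), let $F_{P_{X|Z}}:\mathcal Z\to\mathcal H_{\mathcal X}$ be any measurable function such that $F_{P_{X|Z}}(Z)$ is a version of the conditional mean embedding $\mathbb E[k_{\mathcal X}(X,\cdot)\mid Z]$, and let $\tilde{\mathcal E}(F)=\mathbb E\,\lVert k_{\mathcal X}(X,\cdot)-F(Z)\rVert_{\mathcal H_{\mathcal X}}^2$. Given an i.i.d. sample $(x_1,z_1),\dots,(x_n,z_n)$ from $P_{XZ}$, let $$\hat F_{n,\lambda}=\sum_{i,j=1}^n k_{\mathcal Z}(\cdot,z_i)\,W_{ij}\,k_{\mathcal X}(x_j,\cdot)\in\mathcal G,\qquad W=(K+n\lambda I)^{-1},\quad K_{ij}=k_{\mathcal Z}(z_i,z_j),$$ which is the unique minimiser over $F\in\mathcal G$ of $\frac1n\sum_{i=1}^n\lVert k_{\mathcal X}(x_i,\cdot)-F(z_i)\rVert_{\mathcal H_{\mathcal X}}^2+\lambda\lVert F\rVert_{\mathcal G}^2$. Then $\hat F_{n,\lambda_n}$ is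 universally consistent in the surrogate loss: for every $P_{XZ}$ and all $\epsilon,\delta>0$, for all sufficiently large $n$, $$P_{XZ}^{\otimes n}\big(\tilde{\mathcal E}(\hat F_{n,\lambda_n})-\tilde{\mathcal E}(F_{P_{X|Z}})>\epsilon\big)<\delta .$$ -/

import Mathlib

open MeasureTheory Filter Topology

noncomputable section

namespace CME

/-! ### Scalar reproducing kernel Hilbert spaces

Reproducing kernel Hilbert spaces are those of Mathlib: `RKHS ℝ H X V` says that the
Hilbert space `H` is a space of functions `X → V` with continuous point evaluations. -/

section Scalar

variable {X : Type*} (HX : Type*) [NormedAddCommGroup HX] [InnerProductSpace ℝ HX]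
  [CompleteSpace HX] [RKHS ℝ HX X ℝ]

/-- The canonical feature `k_X(x, ·)`, as an element of the space `H_X`. -/
def feature (x : X) : HX := RKHS.kerFun HX x (1 : ℝ)

/-- The reproducing kernel `k_X : X × X → ℝ` of `H_X`. -/
def scalarKernel (x x' : X) : ℝ := feature HX x x'

/-- The reproducing property `f(x) = ⟨f, k_X(x, ·)⟩`. -/
theorem inner_feature (f : HX) (x : X) : inner ℝ f (feature HX x) = f x := by
  simp [feature]

end Scalar

/-! ### Vector-valued reproducing kernel Hilbert spaces -/

section Vector

variable {Z : Type*} {V : Type*} [NormedAddCommGroup V] [InnerProductSpace ℝ V]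
variable (G : Type*) [NormedAddCommGroup G] [InnerProductSpace ℝ G] [RKHS ℝ G Z V]

/-- `G` is the `V`-valued reproducing kernel Hilbert space whose operator-valued kernel is
`l(z, z') = k(z, z') Id`. -/
def HasKernelSMulId [CompleteSpace V] [CompleteSpace G] (k : Z → Z → ℝ) : Prop :=
  ∀ z z' : Z, RKHS.kernel G z z' = k z z' • ContinuousLinearMap.id ℝ V

/-- The kernel of `G` is `C₀`: every element of `G` is a continuous function `Z → V` that
vanishes at infinity. -/
def IsC0 [TopologicalSpace Z] : Prop :=
  ∀ F : G, Continuous (fun z : Z => F z) ∧ Tendsto (fun z : Z => F z) (cocompact Z) (𝓝 0)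

/-- The kernel of `G` is `C₀`-universal: it is `C₀`, and `G` is dense in `L²(Z, μ; V)` for every
probability measure `μ` on `Z`. -/
def IsC0Universal [TopologicalSpace Z] [MeasurableSpace Z] : Prop :=
  IsC0 (Z := Z) (V := V) G ∧
    ∀ μ : Measure Z, IsProbabilityMeasure μ →
      Dense {g : Lp V 2 μ | ∃ F : G, (g : Z → V) =ᵐ[μ] fun z => F z}

end Vector

/-! ### The conditional mean embedding and the surrogate loss -/

section Loss

variable {X Z : Type*} [MeasurableSpace X] [MeasurableSpace Z]
variable (HX : Type*) [NormedAddCommGroup HX] [InnerProductSpace ℝ HX]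
  [CompleteSpace HX] [RKHS ℝ HX X ℝ]

/-- The function `F` represents the conditional mean embedding `E[k_X(X, ·) | Z]` for `(X, Z)`
with joint distribution `P`: it is measurable, and `F ∘ Z` is a version of the (Bochner)
conditional expectation of `k_X(X, ·)` given the sigma-algebra generated by `Z`. -/
def IsCMEFunction (P : Measure (X × Z)) (F : Z → HX) : Prop :=
  StronglyMeasurable F ∧
    (fun p : X × Z => F p.2) =ᵐ[P]
      P[fun p : X × Z => feature HX p.1 | MeasurableSpace.comap Prod.snd inferInstance]

/-- Such a function exists. -/
theorem exists_isCMEFunction (P : Measure (X × Z)) : ∃ F : Z → HX, IsCMEFunction HX P F := by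
  have h : StronglyMeasurable[MeasurableSpace.comap (Prod.snd : X × Z → Z) inferInstance]
      (P[fun p : X × Z => feature HX p.1 | MeasurableSpace.comap Prod.snd inferInstance]) :=
    stronglyMeasurable_condExp
  obtain ⟨F, hF, hcomp⟩ := h.exists_eq_measurable_comp
  exact ⟨F, hF, by rw [hcomp]; rfl⟩

/-- The surrogate loss `E[‖k_X(X, ·) - F(Z)‖²]` of `F : Z → H_X`. -/
def surrogateRisk (P : Measure (X × Z)) (F : Z → HX) : ℝ :=
  ∫ p : X × Z, ‖feature HX p.1 - F p.2‖ ^ 2 ∂P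

end Loss

/-! ### Kernel ridge regression -/

section Regression

variable {X Z : Type*}
variable (HX : Type*) [NormedAddCommGroup HX] [InnerProductSpace ℝ HX]
  [CompleteSpace HX] [RKHS ℝ HX X ℝ]
variable {G : Type*} [NormedAddCommGroup G] [InnerProductSpace ℝ G] [RKHS ℝ G Z HX]

/-- The regularised empirical loss
`(1/n) ∑ᵢ ‖k_X(xᵢ, ·) - F(zᵢ)‖² + lam ‖F‖²` of `F` in `G`. -/
def empiricalRisk {n : ℕ} (lam : ℝ) (D : Fin n → X × Z) (F : G) : ℝ :=
  (1 / (n : ℝ)) * ∑ i, ‖feature HX (D i).1 - F (D i).2‖ ^ 2 + lam * ‖F‖ ^ 2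

/-- The matrix `W = (K_Z + n lam I)⁻¹`. -/
def ridgeWeights (kZ : Z → Z → ℝ) {n : ℕ} (lam : ℝ) (D : Fin n → X × Z) :
    Matrix (Fin n) (Fin n) ℝ :=
  (Matrix.of (fun i j => kZ (D i).2 (D j).2) + ((n : ℝ) * lam) • (1 : Matrix (Fin n) (Fin n) ℝ))⁻¹

/-- The coefficients `f = W k_X`, elements of `H_X`. -/
def ridgeCoeff (kZ : Z → Z → ℝ) {n : ℕ} (lam : ℝ) (D : Fin n → X × Z) (i : Fin n) : HX :=
  ∑ j, ridgeWeights kZ lam D i j • feature HX (D j).1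

/-- The kernel ridge regression estimate `k_Zᵀ(·) W k_X = ∑ᵢ l(·, zᵢ) fᵢ`, an element of `G`.
It is the unique minimiser of `empiricalRisk` in `G`, see `empiricalRisk_ridgeEstimate_lt`. -/
def ridgeEstimate (G : Type*) [NormedAddCommGroup G] [InnerProductSpace ℝ G] [CompleteSpace G]
    [RKHS ℝ G Z HX] (kZ : Z → Z → ℝ) {n : ℕ} (lam : ℝ) (D : Fin n → X × Z) : G :=
  ∑ i, RKHS.kerFun G (D i).2 (ridgeCoeff HX kZ lam D i)

variable [CompleteSpace G]

/-- As a function, the estimate is `z ↦ ∑ᵢ k_Z(z, zᵢ) fᵢ`. -/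
theorem ridgeEstimate_apply {kZ : Z → Z → ℝ} (hG : HasKernelSMulId G kZ) {n : ℕ} (lam : ℝ)
    (D : Fin n → X × Z) (z : Z) :
    ridgeEstimate HX G kZ lam D z = ∑ i, kZ z (D i).2 • ridgeCoeff HX kZ lam D i := by
  have h : ∀ F : G, F z = (RKHS.coeCLM ℝ F : Z → HX) z := fun _ => rfl
  rw [h, ridgeEstimate, map_sum, Finset.sum_apply]
  refine Finset.sum_congr rfl fun i _ => ?_
  rw [← h, RKHS.kerFun_apply, hG]
  simp

/-- The coefficients solve the linear system `(K_Z + n lam I) f = k_X`. -/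
theorem ridgeCoeff_system {kZ : Z → Z → ℝ} (hk : (Matrix.of kZ).PosSemidef) {n : ℕ} {lam : ℝ}
    (hlam : 0 < lam) (D : Fin n → X × Z) (i : Fin n) :
    ∑ j, kZ (D i).2 (D j).2 • ridgeCoeff HX kZ lam D j
      + ((n : ℝ) * lam) • ridgeCoeff HX kZ lam D i = feature HX (D i).1 := by
  classical
  have hn : 0 < (n : ℝ) := by exact_mod_cast i.pos
  set A : Matrix (Fin n) (Fin n) ℝ := Matrix.of (fun i j => kZ (D i).2 (D j).2)
    + ((n : ℝ) * lam) • (1 : Matrix (Fin n) (Fin n) ℝ) with hA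
  have hpos : A.PosDef := by
    rw [hA, add_comm]
    exact (Matrix.PosDef.one.smul (mul_pos hn hlam)).add_posSemidef
      (hk.submatrix fun i => (D i).2)
  have hW : A * ridgeWeights kZ lam D = 1 :=
    Matrix.mul_nonsing_inv _ hpos.det_pos.ne'.isUnit
  have key : ∀ i, ∑ j, A i j • ridgeCoeff HX kZ lam D j = feature HX (D i).1 := by
    intro i
    simp only [ridgeCoeff, Finset.smul_sum, smul_smul]
    rw [Finset.sum_comm]
    simp only [← Finset.sum_smul, ← Matrix.mul_apply, hW, Matrix.one_apply, ite_smul, one_smul,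
      zero_smul, Finset.sum_ite_eq, Finset.mem_univ, if_true]
  rw [← key i]
  simp [hA, add_smul, Finset.sum_add_distrib, Matrix.one_apply, mul_ite, ite_smul]

/-- The estimate is the unique minimiser in `G` of the regularised empirical loss. -/
theorem empiricalRisk_ridgeEstimate_lt {kZ : Z → Z → ℝ} (hk : (Matrix.of kZ).PosSemidef)
    (hG : HasKernelSMulId G kZ) {n : ℕ} {lam : ℝ} (hlam : 0 < lam) (D : Fin n → X × Z) (F : G)
    (hF : F ≠ ridgeEstimate HX G kZ lam D) :
    empiricalRisk HX lam D (ridgeEstimate HX G kZ lam D) < empiricalRisk HX lam D F := by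
  set E := ridgeEstimate HX G kZ lam D with hE
  obtain ⟨d, rfl⟩ : ∃ d, F = E + d := ⟨F - E, by abel⟩
  have hd : 0 < ‖d‖ := norm_pos_iff.2 fun h => hF (by simp [h])
  have hres : ∀ i, feature HX (D i).1 - E (D i).2
      = ((n : ℝ) * lam) • ridgeCoeff HX kZ lam D i := fun i => by
    rw [hE, ridgeEstimate_apply HX hG, ← ridgeCoeff_system HX hk hlam D i, add_sub_cancel_left]
  have hin : inner ℝ E d = ∑ i, inner ℝ (ridgeCoeff HX kZ lam D i) (d (D i).2) := by
    rw [hE, ridgeEstimate, sum_inner]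
    simp
  have hsum : ∑ i, ‖feature HX (D i).1 - (E + d) (D i).2‖ ^ 2
      = ∑ i, ‖feature HX (D i).1 - E (D i).2‖ ^ 2 - 2 * ((n : ℝ) * lam) * inner ℝ E d
        + ∑ i, ‖d (D i).2‖ ^ 2 := by
    rw [hin, Finset.mul_sum, ← Finset.sum_sub_distrib, ← Finset.sum_add_distrib]
    refine Finset.sum_congr rfl fun i _ => ?_
    rw [RKHS.coe_add, Pi.add_apply, ← sub_sub, norm_sub_sq_real, hres, real_inner_smul_left]
    ring
  have hnn : 0 ≤ (1 / (n : ℝ)) * ∑ i, ‖d (D i).2‖ ^ 2 := by positivity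
  have hcancel : (1 / (n : ℝ)) * ((n : ℝ) * lam) * inner ℝ E d = lam * inner ℝ E d := by
    rcases Nat.eq_zero_or_pos n with rfl | hn
    · simp [hin]
    · field_simp
  have hlt : 0 < lam * ‖d‖ ^ 2 := by positivity
  simp only [empiricalRisk, hsum, norm_add_sq_real]
  nlinarith

end Regression

end CME

end

/-! Let `A : G → L²(P)` send `F` to `F(Z)`, let `Φ` be the class of the feature `k_X(X, ·)` and `Ψ`
that of its conditional mean. The residual `Φ - Ψ` is orthogonal to functions of `Z`, so Pythagoras
turns the excess risk of `F ∈ G` into `‖A F - Ψ‖²`. The estimate is compared with the deterministic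
minimiser `u_n` of `‖Φ - A F‖² + λ_n ‖F‖²`.

Bias (`tendsto_ridge_solution`): universality puts `Ψ` in the closure of the range of `A`, so `A u_n
→ Ψ` as `λ_n → 0`, without a rate.

Variance (`norm_ridgeEstimate_sub_le`, `score_moments`): strong convexity of the empirical problem
bounds `n λ_n ‖F̂ - u_n‖` by the norm of its half-gradient at `u_n` times `n`. This is a sum of `n`
i.i.d. vectors, centred by the population normal equation, with second moment at most `B_Z² ‖Φ‖²`
whatever `λ_n` is. Chebyshev gives a tail of order `1 / (n λ_n²)`, which vanishes because `√n λ_n →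
∞`. No uniform law over `G` is needed. -/

/-- An orthonormal family in a separable inner product space is countable. -/
theorem Orthonormal.countable_index {ι E : Type*} [NormedAddCommGroup E] [InnerProductSpace ℝ E]
    [TopologicalSpace.SeparableSpace E] {v : ι → E} (hv : Orthonormal ℝ v) : Countable ι := by
  -- Distinct members are at distance `√2 > 1`, so balls of radius `1/2` are disjoint, and
  -- separability allows only countably many.
  have hdisj : (Set.univ : Set ι).PairwiseDisjoint fun i => Metric.ball (v i) (1 / 2) := by
    intro i _ j _ hij
    apply Metric.ball_disjoint_ball
    have h : ‖v i - v j‖ ^ 2 = 2 := by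
      rw [norm_sub_sq_real, hv.1, hv.1, hv.2 hij]
      norm_num
    rw [dist_eq_norm]
    nlinarith [norm_nonneg (v i - v j)]
  have := hdisj.countable_of_isOpen (fun i _ => Metric.isOpen_ball)
    (fun i _ => ⟨v i, Metric.mem_ball_self (by norm_num)⟩)
  exact Set.countable_univ_iff.1 this

/-- Pettis' theorem in a separable Hilbert space: a weakly measurable function is strongly
measurable. -/
theorem stronglyMeasurable_of_inner {α E : Type*} [MeasurableSpace α] [NormedAddCommGroup E]
    [InnerProductSpace ℝ E] [CompleteSpace E] [TopologicalSpace.SeparableSpace E] {f : α → E}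
    (hf : ∀ e : E, Measurable fun x => inner ℝ e (f x)) : StronglyMeasurable f := by
  obtain ⟨w, b, -⟩ := exists_hilbertBasis ℝ E
  have : Countable w := b.orthonormal.countable_index
  -- Partial sums of the basis expansion converge pointwise along finite subsets of `w`;
  -- countability of `w` makes this filter countably generated.
  refine stronglyMeasurable_of_tendsto (atTop : Filter (Finset w))
    (f := fun s x => ∑ i ∈ s, inner ℝ (b i) (f x) • b i) (fun s => ?_) ?_
  · exact Finset.stronglyMeasurable_fun_sum s fun i _ =>
      (hf (b i)).stronglyMeasurable.smul_const (b i)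
  · rw [tendsto_pi_nhds]
    intro x
    simpa [b.repr_apply_apply, HasSum] using b.hasSum_repr (f x)

/-! ### Regularised least squares in Hilbert spaces -/

/-- Regularised least squares: for a bounded operator `A` between Hilbert spaces and `c > 0`, the
normal equation `A† (y - A u) = c u` has a solution. -/
theorem exists_ridge_solution {E F : Type*} [NormedAddCommGroup E] [InnerProductSpace ℝ E]
    [CompleteSpace E] [NormedAddCommGroup F] [InnerProductSpace ℝ F] [CompleteSpace F]
    (A : E →L[ℝ] F) (y : F) {c : ℝ} (hc : 0 < c) :
    ∃ u : E, ∀ v, inner ℝ (y - A u) (A v) = c * inner ℝ u v := by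
  -- Lax–Milgram for `⟨A u, A v⟩ + c ⟨u, v⟩`, coercive with constant `c`.
  let B : E →L[ℝ] E →L[ℝ] ℝ := (innerSL ℝ).bilinearComp A A + c • innerSL ℝ
  have hB : ∀ u v, B u v = inner ℝ (A u) (A v) + c * inner ℝ u v := fun u v => by
    simp [B]
    exact Or.inl rfl
  have hcoer : IsCoercive B := by
    refine ⟨c, hc, fun u => ?_⟩
    rw [hB, real_inner_self_eq_norm_sq, real_inner_self_eq_norm_sq]
    nlinarith [sq_nonneg ‖A u‖]
  obtain ⟨u, hu⟩ := hcoer.continuousLinearEquivOfBilin.surjective (A.adjoint y)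
  refine ⟨u, fun v => ?_⟩
  have h := hcoer.continuousLinearEquivOfBilin_apply u v
  rw [hu, hB, ContinuousLinearMap.adjoint_inner_left] at h
  rw [inner_sub_left, h]
  ring

/-- A solution of the normal equation minimises the regularised least squares functional. -/
theorem ridge_solution_le {E F : Type*} [NormedAddCommGroup E] [InnerProductSpace ℝ E]
    [NormedAddCommGroup F] [InnerProductSpace ℝ F] {A : E →L[ℝ] F} {y : F} {c : ℝ} (hc : 0 ≤ c)
    {u : E} (hu : ∀ v, inner ℝ (y - A u) (A v) = c * inner ℝ u v) (v : E) :
    ‖y - A u‖ ^ 2 + c * ‖u‖ ^ 2 ≤ ‖y - A v‖ ^ 2 + c * ‖v‖ ^ 2 := by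
  obtain ⟨d, rfl⟩ : ∃ d, v = u + d := ⟨v - u, by abel⟩
  rw [map_add, ← sub_sub, norm_sub_sq_real (y - A u), hu, norm_add_sq_real]
  nlinarith [sq_nonneg ‖A d‖, mul_nonneg hc (sq_nonneg ‖d‖)]

/-- If the range of `A` approaches a vector `q`, and `y - q` is orthogonal to `q` and to the range
of `A`, then the regularised solutions converge to `q` as the regularisation vanishes. -/
theorem tendsto_ridge_solution {E F : Type*} [NormedAddCommGroup E] [InnerProductSpace ℝ E]
    [NormedAddCommGroup F] [InnerProductSpace ℝ F] {A : E →L[ℝ] F} {y q : F}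
    (hy : ∀ v, ‖y - A v‖ ^ 2 = ‖y - q‖ ^ 2 + ‖A v - q‖ ^ 2)
    (hq : q ∈ closure (Set.range A)) {c : ℕ → ℝ} (hc : ∀ n, 0 ≤ c n)
    (hc0 : Tendsto c atTop (𝓝 0)) {u : ℕ → E}
    (hu : ∀ n v, inner ℝ (y - A (u n)) (A v) = c n * inner ℝ (u n) v) :
    Tendsto (fun n => ‖A (u n) - q‖) atTop (𝓝 0) := by
  rw [Metric.tendsto_atTop']
  intro ε hε
  obtain ⟨_, ⟨v, rfl⟩, hv⟩ := Metric.mem_closure_iff.1 hq (ε / 2) (by positivity)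
  rw [dist_eq_norm'] at hv
  have hlim : Tendsto (fun n => c n * ‖v‖ ^ 2) atTop (𝓝 0) := by
    simpa using hc0.mul_const (‖v‖ ^ 2)
  -- The competitor `v` costs less than `ε²/4` in distance and `ε²/4` in penalty, in total below
  -- `ε²`.
  obtain ⟨N, hN⟩ := eventually_atTop.1 (hlim.eventually_lt_const (show 0 < ε ^ 2 / 4 by positivity))
  refine ⟨N, fun n hn => ?_⟩
  have h := ridge_solution_le (hc n) (hu n) v
  rw [hy, hy] at h
  have h2 : ‖A v - q‖ ^ 2 < (ε / 2) ^ 2 := by gcongr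
  have h3 := mul_nonneg (hc n) (sq_nonneg ‖u n‖)
  have h4 := hN n hn.le
  simp only [dist_zero_right, norm_norm]
  refine lt_of_pow_lt_pow_left₀ 2 hε.le ?_
  nlinarith

/-! ### Second moments of i.i.d. sums -/

/-- The pointwise inner product of two square integrable functions is integrable. -/
theorem MeasureTheory.MemLp.integrable_inner {α E : Type*} [MeasurableSpace α]
    [NormedAddCommGroup E] [InnerProductSpace ℝ E] {μ : Measure α} {f g : α → E}
    (hf : MemLp f 2 μ) (hg : MemLp g 2 μ) : Integrable (fun x => inner ℝ (f x) (g x)) μ := by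
  refine (L2.integrable_inner (𝕜 := ℝ) (hf.toLp f) (hg.toLp g)).congr ?_
  filter_upwards [hf.coeFn_toLp, hg.coeFn_toLp] with x h1 h2
  rw [h1, h2]

/-- The second moment of a sum of `n` i.i.d. centred vectors in a Hilbert space is `n` times that of
one of them. -/
theorem integral_norm_sum_sq_pi {Ω E : Type*} [MeasurableSpace Ω] [NormedAddCommGroup E]
    [InnerProductSpace ℝ E] [CompleteSpace E] (P : Measure Ω) [IsProbabilityMeasure P]
    {f : Ω → E} (hf : MemLp f 2 P) (hf0 : ∫ ω, f ω ∂P = 0) (n : ℕ) :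
    Integrable (fun D : Fin n → Ω => ‖∑ i, f (D i)‖ ^ 2) (Measure.pi fun _ => P) ∧
    ∫ D : Fin n → Ω, ‖∑ i, f (D i)‖ ^ 2 ∂(Measure.pi fun _ => P) = n * ∫ ω, ‖f ω‖ ^ 2 ∂P := by
  borelize E
  have hint : Integrable f P := hf.integrable (by norm_num)
  have hmem : ∀ i : Fin n, MemLp (fun D : Fin n → Ω => f (D i)) 2 (Measure.pi fun _ => P) :=
    fun i => hf.comp_measurePreserving (measurePreserving_eval _ i)
  have hinner : ∀ i j : Fin n, Integrable (fun D : Fin n → Ω => inner ℝ (f (D i)) (f (D j)))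
      (Measure.pi fun _ => P) := fun i j => (hmem i).integrable_inner (hmem j)
  have hindep : ProbabilityTheory.iIndepFun (fun (i : Fin n) (D : Fin n → Ω) => f (D i))
      (Measure.pi fun _ => P) :=
    ProbabilityTheory.iIndepFun_pi fun _ => hf.1.aemeasurable
  have hcross : ∀ i j : Fin n, ∫ D : Fin n → Ω, inner ℝ (f (D i)) (f (D j))
      ∂(Measure.pi fun _ => P) = if i = j then ∫ ω, ‖f ω‖ ^ 2 ∂P else 0 := by
    intro i j
    split_ifs with hij
    · subst hij
      simp only [real_inner_self_eq_norm_sq]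
      exact integral_comp_eval (μ := fun _ : Fin n => P) (f := fun ω => ‖f ω‖ ^ 2)
        (hf.1.norm.pow 2)
    -- By independence the cross term is the inner product of the two means, both zero.
    · have h := (hindep.indepFun hij).integral_bilin ((hmem i).integrable (by norm_num))
        ((hmem j).integrable (by norm_num)) (innerSL ℝ)
      have h0 : ∫ D : Fin n → Ω, f (D i) ∂(Measure.pi fun _ => P) = 0 := by
        rw [integral_comp_eval (μ := fun _ : Fin n => P) (f := f) hf.1, hf0]
      rw [h0, map_zero] at h
      exact h
  have hexp : ∀ D : Fin n → Ω, ‖∑ i, f (D i)‖ ^ 2 = ∑ i, ∑ j, inner ℝ (f (D i)) (f (D j)) := by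
    intro D
    simp_rw [← real_inner_self_eq_norm_sq, sum_inner, inner_sum]
  simp_rw [hexp]
  refine ⟨integrable_finsetSum _ fun i _ => integrable_finsetSum _ fun j _ => hinner i j, ?_⟩
  rw [integral_finsetSum _ fun i _ => integrable_finsetSum _ fun j _ => hinner i j]
  simp_rw [integral_finsetSum _ fun j _ => hinner _ j, hcross]
  simp

namespace CME

/-! ### Measurability and boundedness in the two RKHSs -/

section Feature

variable {X HX : Type*} [NormedAddCommGroup HX] [InnerProductSpace ℝ HX]
  [CompleteSpace HX] [RKHS ℝ HX X ℝ]

theorem norm_feature_le {B : ℝ} (hB : 0 ≤ B) {x : X} (h : scalarKernel HX x x ≤ B ^ 2) :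
    ‖feature HX x‖ ≤ B := by
  rw [scalarKernel, ← inner_feature, real_inner_self_eq_norm_sq] at h
  exact le_of_sq_le_sq h hB

/-- The elements of `HX` that are measurable functions form a subspace, closed because norm
convergence implies pointwise convergence. It contains the features, whose span is dense. -/
theorem measurable_coe [MeasurableSpace X] (hk : ∀ x : X, Measurable (scalarKernel HX x))
    (e : HX) : Measurable fun x : X => e x := by
  let S : Submodule ℝ HX :=
    { carrier := {e | Measurable fun x : X => e x}
      zero_mem' := by simp
      add_mem' := fun {a b} ha hb => by simpa using! Measurable.add ha hb
      smul_mem' := fun c a ha => by simpa using! Measurable.const_smul ha c }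
  have hS : IsClosed (S : Set HX) := by
    refine IsSeqClosed.isClosed fun u a hu hua => ?_
    refine measurable_of_tendsto_metrizable (f := fun n x => u n x) hu ?_
    rw [tendsto_pi_nhds]
    exact fun x => ((RKHS.continuous_eval (H := HX) x).tendsto a).comp hua
  have hspan : Submodule.span ℝ {RKHS.kerFun HX x v | (x : X) (v : ℝ)} ≤ S := by
    rw [Submodule.span_le]
    rintro _ ⟨x, v, rfl⟩
    have : RKHS.kerFun HX x v = v • feature HX x := by
      rw [feature, ← map_smul, smul_eq_mul, mul_one]
    rw [this]
    exact S.smul_mem v (hk x)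
  have := Submodule.topologicalClosure_minimal _ hspan hS
  rw [RKHS.kerFun_dense] at this
  exact this (Submodule.mem_top (x := e))

theorem stronglyMeasurable_feature [MeasurableSpace X] [TopologicalSpace.SeparableSpace HX]
    (hk : ∀ x : X, Measurable (scalarKernel HX x)) :
    StronglyMeasurable fun x : X => feature HX x :=
  stronglyMeasurable_of_inner fun e => by
    simpa only [inner_feature] using measurable_coe hk e

end Feature

section Evaluation

variable {Z V G : Type*} [NormedAddCommGroup V] [InnerProductSpace ℝ V] [CompleteSpace V]
  [NormedAddCommGroup G] [InnerProductSpace ℝ G] [CompleteSpace G] [RKHS ℝ G Z V]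

theorem norm_kerFun_le {kZ : Z → Z → ℝ} (hkZ : (Matrix.of kZ).PosSemidef)
    (hG : HasKernelSMulId G kZ) {B : ℝ} (hB : 0 ≤ B) {z : Z} (h : kZ z z ≤ B ^ 2) :
    ‖RKHS.kerFun G z‖ ≤ B := by
  have h0 : 0 ≤ kZ z z := hkZ.diag_nonneg
  rw [RKHS.norm_kerFun_eq_sqrt_norm_kernel, hG]
  refine Real.sqrt_le_iff.2 ⟨hB, ?_⟩
  calc ‖kZ z z • ContinuousLinearMap.id ℝ V‖ ≤ ‖kZ z z‖ * 1 := by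
        rw [norm_smul]
        gcongr
        exact ContinuousLinearMap.norm_id_le
    _ ≤ B ^ 2 := by rwa [mul_one, Real.norm_of_nonneg h0]

theorem norm_coe_le {B : ℝ} (hB : ∀ z : Z, ‖RKHS.kerFun G z‖ ≤ B) (F : G) (z : Z) :
    ‖F z‖ ≤ B * ‖F‖ := by
  have h := RKHS.norm_apply_le F z
  rw [← RKHS.norm_kerFun_eq_sqrt_norm_kernel, mul_comm] at h
  exact h.trans (by gcongr; exact hB z)

/-- The inclusion of a bounded reproducing kernel Hilbert space of measurable functions into
`L²`, along a random variable. -/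
theorem exists_toL2 {Ω : Type*} [MeasurableSpace Ω] [MeasurableSpace Z] (P : Measure Ω)
    [IsProbabilityMeasure P] {Y : Ω → Z} (hY : Measurable Y)
    {B : ℝ} (hB0 : 0 ≤ B) (hB : ∀ z : Z, ‖RKHS.kerFun G z‖ ≤ B)
    (hmeas : ∀ F : G, StronglyMeasurable fun z : Z => F z) :
    ∃ A : G →L[ℝ] Lp V 2 P, (∀ F, A F =ᵐ[P] fun ω => F (Y ω)) ∧ ∀ F, ‖A F‖ ≤ B * ‖F‖ := by
  have hmem : ∀ F : G, MemLp (fun ω => F (Y ω)) 2 P := fun F =>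
    MemLp.of_bound ((hmeas F).comp_measurable hY).aestronglyMeasurable (B * ‖F‖)
      (ae_of_all _ fun ω => norm_coe_le hB F (Y ω))
  let L : G →ₗ[ℝ] Lp V 2 P :=
    { toFun := fun F => (hmem F).toLp _
      map_add' := fun F F' => by
        rw [← MemLp.toLp_add]
        exact MemLp.toLp_congr _ _ (ae_of_all _ fun ω => by simp)
      map_smul' := fun c F => by
        rw [RingHom.id_apply, ← MemLp.toLp_const_smul]
        exact MemLp.toLp_congr _ _ (ae_of_all _ fun ω => by simp) }
  have hbound : ∀ F, ‖L F‖ ≤ B * ‖F‖ := by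
    intro F
    have := Lp.norm_le_of_ae_bound (f := L F) (C := B * ‖F‖) (by positivity) (by
      filter_upwards [(hmem F).coeFn_toLp] with ω hω
      change ‖(hmem F).toLp _ ω‖ ≤ _
      rw [hω]
      exact norm_coe_le hB F (Y ω))
    simpa [measureUnivNNReal] using this
  exact ⟨L.mkContinuous B hbound, fun F => (hmem F).coeFn_toLp, hbound⟩

end Evaluation

/-! ### Orthogonality, density and the excess risk -/

section ConditionalMean

variable {X Z HX : Type*} [MeasurableSpace X] [MeasurableSpace Z] [NormedAddCommGroup HX]
  [InnerProductSpace ℝ HX] [CompleteSpace HX] [RKHS ℝ HX X ℝ]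

theorem IsCMEFunction.memLp {P : Measure (X × Z)} [IsProbabilityMeasure P] {FP : Z → HX}
    (hFP : IsCMEFunction HX P FP)
    (hφ : MemLp (fun p : X × Z => feature HX p.1) 2 P) :
    MemLp (fun p : X × Z => FP p.2) 2 P :=
  (hφ.condExp (by norm_num)).ae_eq hFP.2.symm

/-- The residual of the conditional mean embedding is orthogonal to all functions of `Z`. -/
theorem IsCMEFunction.integral_inner_sub {P : Measure (X × Z)} [IsProbabilityMeasure P]
    {FP : Z → HX} (hFP : IsCMEFunction HX P FP)
    (hφ : MemLp (fun p : X × Z => feature HX p.1) 2 P) {h : Z → HX} (hh : StronglyMeasurable h)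
    (hh2 : MemLp (fun p : X × Z => h p.2) 2 P) :
    ∫ p : X × Z, inner ℝ (h p.2) (feature HX p.1 - FP p.2) ∂P = 0 := by
  have hm : MeasurableSpace.comap (Prod.snd : X × Z → Z) inferInstance
      ≤ (inferInstance : MeasurableSpace (X × Z)) := measurable_snd.comap_le
  -- Pull-out property: `E[⟨h(Z), k_X(X, ·)⟩ | Z] = ⟨h(Z), E[k_X(X, ·) | Z]⟩`.
  have hpull := condExp_bilin_of_stronglyMeasurable_left (μ := P) (innerSL ℝ)
    (m := MeasurableSpace.comap (Prod.snd : X × Z → Z) inferInstance)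
    (f := fun p : X × Z => h p.2) (g := fun p : X × Z => feature HX p.1)
    (hh.comp_measurable (comap_measurable _)) (hh2.integrable_inner hφ)
    (hφ.integrable (by norm_num))
  simp only [inner_sub_right]
  rw [integral_sub (hh2.integrable_inner hφ) (hh2.integrable_inner (hFP.memLp hφ)), sub_eq_zero]
  calc ∫ p : X × Z, inner ℝ (h p.2) (feature HX p.1) ∂P = _ := (integral_condExp hm).symm
    _ = _ := integral_congr_ae hpull
    _ = _ := integral_congr_ae (by
        filter_upwards [hFP.2] with p hp
        rw [innerSL_apply_apply, ← hp])

end ConditionalMean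

/-- Density in `L²` of the law of `Z` passes to `L²` of the joint law. -/
theorem mem_closure_range_toL2 {X Z V G : Type*} [MeasurableSpace X] [TopologicalSpace Z]
    [MeasurableSpace Z] [NormedAddCommGroup V] [InnerProductSpace ℝ V] [NormedAddCommGroup G]
    [InnerProductSpace ℝ G] [RKHS ℝ G Z V] (huniv : IsC0Universal (Z := Z) (V := V) G)
    {P : Measure (X × Z)} [IsProbabilityMeasure P] {A : G → Lp V 2 P} (hA : ∀ F, A F =ᵐ[P] fun p => F p.2)
    {f : Z → V} (hf : StronglyMeasurable f) (hf2 : MemLp (fun p : X × Z => f p.2) 2 P) :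
    hf2.toLp _ ∈ closure (Set.range A) := by
  have hsnd : MeasurePreserving (Prod.snd : X × Z → Z) P (P.map Prod.snd) :=
    ⟨measurable_snd, rfl⟩
  have hfμ : MemLp f 2 (P.map Prod.snd) :=
    (memLp_map_measure_iff hf.aestronglyMeasurable measurable_snd.aemeasurable).2 hf2
  have hdense := huniv.2 (P.map Prod.snd)
    (Measure.isProbabilityMeasure_map measurable_snd.aemeasurable) (hfμ.toLp f)
  -- Composition with the projection is an isometry from `L²` of the law of `Z` into `L²(P)`, so it
  -- preserves closures.
  have h := map_mem_closure (t := Set.range A)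
    (Lp.compMeasurePreservingₗᵢ ℝ (Prod.snd : X × Z → Z) hsnd).continuous hdense ?_
  · exact h
  · rintro g ⟨F, hF⟩
    refine ⟨F, Lp.ext ?_⟩
    have h1 := Lp.coeFn_compMeasurePreserving g hsnd
    have h2 := hsnd.quasiMeasurePreserving.ae_eq_comp hF
    exact (hA F).trans (h2.symm.trans h1.symm)

section Risk

variable {X Z HX : Type*} [MeasurableSpace X] [MeasurableSpace Z] [NormedAddCommGroup HX]
  [InnerProductSpace ℝ HX] [CompleteSpace HX] [RKHS ℝ HX X ℝ]
  {P : Measure (X × Z)}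

theorem surrogateRisk_eq_norm_sq (hφ : MemLp (fun p : X × Z => feature HX p.1) 2 P) {F : Z → HX}
    {T : Lp HX 2 P} (hT : T =ᵐ[P] fun p => F p.2) :
    surrogateRisk HX P F = ‖hφ.toLp _ - T‖ ^ 2 := by
  rw [← real_inner_self_eq_norm_sq, L2.inner_def]
  refine integral_congr_ae ?_
  filter_upwards [Lp.coeFn_sub (hφ.toLp _) T, hφ.coeFn_toLp, hT] with p h1 h2 h3
  rw [h1, Pi.sub_apply, h2, h3, real_inner_self_eq_norm_sq]

/-- The excess surrogate risk is a squared distance in `L²`. -/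
theorem IsCMEFunction.norm_sub_sq [IsProbabilityMeasure P] {FP : Z → HX}
    (hFP : IsCMEFunction HX P FP) (hφ : MemLp (fun p : X × Z => feature HX p.1) 2 P)
    {F : Z → HX} (hF : StronglyMeasurable F) {T : Lp HX 2 P} (hT : T =ᵐ[P] fun p => F p.2) :
    ‖hφ.toLp _ - T‖ ^ 2 = ‖hφ.toLp _ - (hFP.memLp hφ).toLp _‖ ^ 2
      + ‖T - (hFP.memLp hφ).toLp _‖ ^ 2 := by
  have hF2 : MemLp (fun p : X × Z => F p.2) 2 P := (Lp.memLp T).ae_eq hT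
  have horth : inner ℝ (T - (hFP.memLp hφ).toLp _) (hφ.toLp _ - (hFP.memLp hφ).toLp _) = 0 := by
    rw [L2.inner_def, ← hFP.integral_inner_sub hφ (hF.sub hFP.1) (hF2.sub (hFP.memLp hφ))]
    refine integral_congr_ae ?_
    filter_upwards [Lp.coeFn_sub (hφ.toLp _) ((hFP.memLp hφ).toLp _),
      Lp.coeFn_sub T ((hFP.memLp hφ).toLp _), hφ.coeFn_toLp, (hFP.memLp hφ).coeFn_toLp, hT]
      with p h1 h2 h3 h4 h5
    rw [h1, h2, Pi.sub_apply, Pi.sub_apply, h3, h4, h5, Pi.sub_apply]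
  rw [← sub_sub_sub_cancel_right (hφ.toLp _) T ((hFP.memLp hφ).toLp _), norm_sub_sq_real,
    real_inner_comm, horth]
  ring

end Risk

/-! ### Concentration of the ridge estimate -/

section Ridge

variable {X Z HX G : Type*} [NormedAddCommGroup HX]
  [InnerProductSpace ℝ HX] [CompleteSpace HX] [RKHS ℝ HX X ℝ]
  [NormedAddCommGroup G] [InnerProductSpace ℝ G] [CompleteSpace G] [RKHS ℝ G Z HX]

variable (HX) in
/-- The gradient at `u` of `F ↦ -‖k_X(x, ·) - F(z)‖² / 2` on `G`, as a function of the
observation `(x, z)`. -/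
noncomputable def score (u : G) (p : X × Z) : G := RKHS.kerFun G p.2 (feature HX p.1 - u p.2)

/-- The distance of the ridge estimate to any `u` is controlled by the empirical normal equation
at `u`. -/
theorem norm_ridgeEstimate_sub_le {kZ : Z → Z → ℝ} (hk : (Matrix.of kZ).PosSemidef)
    (hG : HasKernelSMulId G kZ) {n : ℕ} {lam : ℝ} (hlam : 0 < lam) (D : Fin n → X × Z) (u : G) :
    n * lam * ‖ridgeEstimate HX G kZ lam D - u‖ ≤ ‖∑ i, (score HX u (D i) - lam • u)‖ := by
  set E := ridgeEstimate HX G kZ lam D with hE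
  set d := E - u with hd
  have hres : ∀ i, feature HX (D i).1 - u (D i).2
      = d (D i).2 + ((n : ℝ) * lam) • ridgeCoeff HX kZ lam D i := fun i => by
    rw [← ridgeCoeff_system HX hk hlam D i, ← ridgeEstimate_apply HX hG, ← hE, hd, RKHS.coe_sub,
      Pi.sub_apply]
    abel
  have hin : inner ℝ E d = ∑ i, inner ℝ (ridgeCoeff HX kZ lam D i) (d (D i).2) := by
    rw [hE, ridgeEstimate, sum_inner]
    simp
  -- Pairing with `d` turns each residual into `d(zᵢ) + n lam fᵢ`. The `fᵢ` terms add up to `n lam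
  -- ⟨E, d⟩`, and subtracting `n lam ⟨u, d⟩` leaves `n lam ‖d‖²`. The empirical term is nonnegative,
  -- so Cauchy–Schwarz finishes after dividing by `‖d‖`.
  have hsum : inner ℝ (∑ i, (score HX u (D i) - lam • u)) d
      = ∑ i, ‖d (D i).2‖ ^ 2 + n * lam * ‖d‖ ^ 2 := by
    have hdd : ‖d‖ ^ 2 = inner ℝ E d - inner ℝ u d := by
      rw [← inner_sub_left, ← hd, real_inner_self_eq_norm_sq]
    rw [sum_inner, hdd, hin, mul_sub, Finset.mul_sum]
    simp only [score, hres, inner_sub_left, RKHS.kerFun_inner, inner_add_left,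
      real_inner_smul_left, real_inner_self_eq_norm_sq, Finset.sum_sub_distrib,
      Finset.sum_add_distrib, Finset.sum_const, Finset.card_univ, Fintype.card_fin, nsmul_eq_mul]
    ring
  have hcs := real_inner_le_norm (∑ i, (score HX u (D i) - lam • u)) d
  have hnn : 0 ≤ ∑ i, ‖d (D i).2‖ ^ 2 := by positivity
  rcases (norm_nonneg d).eq_or_lt with h0 | h0
  · rw [← h0, mul_zero]
    positivity
  · refine le_of_mul_le_mul_right ?_ h0
    nlinarith

variable [MeasurableSpace X] [MeasurableSpace Z] [TopologicalSpace.SeparableSpace G]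
  {P : Measure (X × Z)} [IsProbabilityMeasure P]

/-- Pairing with `F` gives the scalar `⟨F(z), k_X(x, ·) - u(z)⟩`, so Pettis' theorem applies without
any measurability of `z ↦ RKHS.kerFun G z`. -/
theorem stronglyMeasurable_score
    (hφ : StronglyMeasurable fun x : X => feature HX x)
    (hmeas : ∀ F : G, StronglyMeasurable fun z : Z => F z) (u : G) :
    StronglyMeasurable fun p : X × Z => score HX u p := by
  refine stronglyMeasurable_of_inner fun F => ?_
  simp only [score, RKHS.inner_kerFun]
  exact (((hmeas F).comp_measurable measurable_snd).inner
    ((hφ.comp_measurable measurable_fst).sub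
      ((hmeas u).comp_measurable measurable_snd))).measurable

/-- Moments of the score at a solution of the population normal equation. -/
theorem score_moments {B : ℝ} (hB : ∀ z : Z, ‖RKHS.kerFun G z‖ ≤ B)
    (hφ : StronglyMeasurable fun x : X => feature HX x)
    (hφ2 : MemLp (fun p : X × Z => feature HX p.1) 2 P)
    (hmeas : ∀ F : G, StronglyMeasurable fun z : Z => F z)
    {A : G →L[ℝ] Lp HX 2 P} (hA : ∀ F, A F =ᵐ[P] fun p => F p.2) {c : ℝ} (hc : 0 ≤ c) {u : G}
    (hu : ∀ v, inner ℝ (hφ2.toLp _ - A u) (A v) = c * inner ℝ u v) :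
    MemLp (fun p : X × Z => score HX u p - c • u) 2 P ∧
    ∫ p, (score HX u p - c • u) ∂P = 0 ∧
    ∫ p, ‖score HX u p - c • u‖ ^ 2 ∂P ≤ B ^ 2 * ‖hφ2.toLp _‖ ^ 2 := by
  have hu2 : MemLp (fun p : X × Z => u p.2) 2 P := (Lp.memLp _).ae_eq (hA u)
  have hres : MemLp (fun p : X × Z => feature HX p.1 - u p.2) 2 P := hφ2.sub hu2
  have hle : ∀ p : X × Z, ‖score HX u p‖ ≤ B * ‖feature HX p.1 - u p.2‖ := fun p =>
    (ContinuousLinearMap.le_opNorm _ _).trans (by gcongr; exact hB p.2)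
  have hs : MemLp (fun p : X × Z => score HX u p) 2 P :=
    hres.of_le_mul (stronglyMeasurable_score hφ hmeas u).aestronglyMeasurable (ae_of_all _ hle)
  have hsint := hs.integrable (by norm_num)
  have hae : (hφ2.toLp _ - A u : Lp HX 2 P) =ᵐ[P] fun p => feature HX p.1 - u p.2 := by
    filter_upwards [Lp.coeFn_sub (hφ2.toLp _) (A u), hφ2.coeFn_toLp, hA u] with p h1 h2 h3
    rw [h1, Pi.sub_apply, h2, h3]
  -- Tested against `v`, this is exactly the population normal equation.
  have hmean : ∫ p, score HX u p ∂P = c • u := by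
    refine ext_inner_left ℝ fun v => ?_
    rw [← integral_inner hsint, real_inner_smul_right, real_inner_comm, ← hu v, real_inner_comm,
      L2.inner_def]
    refine integral_congr_ae ?_
    filter_upwards [hae, hA v] with p h1 h2
    rw [h1, h2, score, RKHS.inner_kerFun]
  refine ⟨hs.sub (memLp_const _), ?_, ?_⟩
  · rw [integral_sub hsint (integrable_const _), hmean]
    simp
  have hsq : Integrable (fun p => ‖score HX u p‖ ^ 2) P := hs.norm.integrable_sq
  have hin : Integrable (fun p => inner ℝ (c • u) (score HX u p)) P := hsint.const_inner _
  have hdiff : Integrable (fun p => ‖score HX u p‖ ^ 2 - 2 * inner ℝ (c • u) (score HX u p)) P :=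
    hsq.sub (hin.const_mul 2)
  calc ∫ p, ‖score HX u p - c • u‖ ^ 2 ∂P
      = ∫ p, (‖score HX u p‖ ^ 2 - 2 * inner ℝ (c • u) (score HX u p) + ‖c • u‖ ^ 2) ∂P := by
        refine integral_congr_ae (ae_of_all _ fun p => ?_)
        simp only [norm_sub_sq_real, real_inner_comm]
    _ = ∫ p, ‖score HX u p‖ ^ 2 ∂P - ‖c • u‖ ^ 2 := by
        rw [integral_add hdiff (integrable_const _),
          integral_sub hsq (hin.const_mul 2), integral_const_mul, integral_inner hsint, hmean,
          real_inner_self_eq_norm_sq]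
        simp
        ring
    _ ≤ ∫ p, ‖score HX u p‖ ^ 2 ∂P := by linarith [sq_nonneg ‖c • u‖]
    _ ≤ ∫ p, B ^ 2 * ‖feature HX p.1 - u p.2‖ ^ 2 ∂P := by
        refine integral_mono hsq (hres.norm.integrable_sq.const_mul _) fun p => ?_
        simp only
        rw [← mul_pow]
        gcongr
        exact hle p
    _ = B ^ 2 * ‖hφ2.toLp _ - A u‖ ^ 2 := by
        rw [integral_const_mul, ← surrogateRisk_eq_norm_sq hφ2 (hA u), surrogateRisk]
    _ ≤ B ^ 2 * ‖hφ2.toLp _‖ ^ 2 := by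
        -- The competitor `0` bounds the residual by `‖Φ‖`, independently of `c`.
        have h := ridge_solution_le hc hu 0
        simp only [map_zero, sub_zero, norm_zero] at h
        have := mul_nonneg hc (sq_nonneg ‖u‖)
        gcongr ?_ * ?_
        linarith

/-- The ridge estimate concentrates around the solution of the population problem. -/
theorem measure_ridgeEstimate_sub_ge_le {kZ : Z → Z → ℝ} (hk : (Matrix.of kZ).PosSemidef)
    (hG : HasKernelSMulId G kZ) {B : ℝ} (hB : ∀ z : Z, ‖RKHS.kerFun G z‖ ≤ B)
    (hφ : StronglyMeasurable fun x : X => feature HX x)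
    (hφ2 : MemLp (fun p : X × Z => feature HX p.1) 2 P)
    (hmeas : ∀ F : G, StronglyMeasurable fun z : Z => F z)
    {A : G →L[ℝ] Lp HX 2 P} (hA : ∀ F, A F =ᵐ[P] fun p => F p.2) {lam : ℝ} (hlam : 0 < lam)
    {u : G} (hu : ∀ v, inner ℝ (hφ2.toLp _ - A u) (A v) = lam * inner ℝ u v)
    {n : ℕ} (hn : 0 < n) {t : ℝ} (ht : 0 < t) :
    Measure.pi (fun _ : Fin n => P) {D | t ≤ ‖ridgeEstimate HX G kZ lam D - u‖}
      ≤ ENNReal.ofReal (B ^ 2 * ‖hφ2.toLp _‖ ^ 2 / (n * (lam * t) ^ 2)) := by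
  obtain ⟨h2, h0, hvar⟩ := score_moments hB hφ hφ2 hmeas hA hlam.le hu
  obtain ⟨hint, hval⟩ := integral_norm_sum_sq_pi P h2 h0 n
  have hn' : (0 : ℝ) < n := by exact_mod_cast hn
  have hs : (0 : ℝ) < (n * lam * t) ^ 2 := by positivity
  have hmarkov := mul_meas_ge_le_integral_of_nonneg (ae_of_all _ fun D => by positivity) hint
    ((n * lam * t) ^ 2)
  rw [hval] at hmarkov
  calc Measure.pi (fun _ : Fin n => P) {D | t ≤ ‖ridgeEstimate HX G kZ lam D - u‖}
      ≤ Measure.pi (fun _ : Fin n => P)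
          {D | (n * lam * t) ^ 2 ≤ ‖∑ i, (score HX u (D i) - lam • u)‖ ^ 2} := by
        refine measure_mono fun D hD => ?_
        have hD' : t ≤ ‖ridgeEstimate HX G kZ lam D - u‖ := hD
        have := norm_ridgeEstimate_sub_le hk hG hlam D u
        refine pow_le_pow_left₀ (by positivity) (le_trans ?_ this) 2
        gcongr
    _ = ENNReal.ofReal ((Measure.pi (fun _ : Fin n => P)).real
          {D | (n * lam * t) ^ 2 ≤ ‖∑ i, (score HX u (D i) - lam • u)‖ ^ 2}) := by
        rw [ofReal_measureReal]
    _ ≤ _ := by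
        refine ENNReal.ofReal_le_ofReal ?_
        rw [le_div_iff₀ (by positivity)]
        -- The variance grows like `n` and the squared threshold like `n²`: one factor `n` cancels.
        refine le_of_mul_le_mul_left ?_ hn'
        calc _ = (n * lam * t) ^ 2 * (Measure.pi (fun _ : Fin n => P)).real
              {D | (n * lam * t) ^ 2 ≤ ‖∑ i, (score HX u (D i) - lam • u)‖ ^ 2} := by ring
          _ ≤ _ := hmarkov
          _ ≤ _ := by gcongr

end Ridge

end CME

/-! ### Universal consistency -/

theorem theorem4p4
    {X Z HX G : Type*} [MeasurableSpace X]
    [TopologicalSpace Z] [MeasurableSpace Z] [OpensMeasurableSpace Z]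
    [NormedAddCommGroup HX] [InnerProductSpace ℝ HX] [CompleteSpace HX]
    [TopologicalSpace.SeparableSpace HX] [RKHS ℝ HX X ℝ]
    [NormedAddCommGroup G] [InnerProductSpace ℝ G] [CompleteSpace G]
    [TopologicalSpace.SeparableSpace G] [RKHS ℝ G Z HX]
    (hkX : ∀ x : X, Measurable (CME.scalarKernel HX x))
    (kZ : Z → Z → ℝ) (hkZ : (Matrix.of kZ).PosSemidef)
    (hG : CME.HasKernelSMulId G kZ)
    (BX BZ : ℝ) (hBX : 0 < BX) (hBZ : 0 < BZ)
    (hkXb : ∀ x : X, CME.scalarKernel HX x x ≤ BX ^ 2)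
    (hkZb : ∀ z : Z, kZ z z ≤ BZ ^ 2)
    (huniv : CME.IsC0Universal (Z := Z) (V := HX) G)
    (lam : ℕ → ℝ) (hlam_pos : ∀ n, 0 < lam n)
    (hlam_zero : Tendsto lam atTop (𝓝 0))
    (hlam_slow : Tendsto (fun n : ℕ => Real.sqrt n * lam n) atTop atTop) :
    ∀ (P : Measure (X × Z)), IsProbabilityMeasure P →
      ∀ FP : Z → HX, CME.IsCMEFunction HX P FP →
        ∀ ε δ : ℝ, 0 < ε → 0 < δ → ∀ᶠ n : ℕ in atTop,
          Measure.pi (fun _ : Fin n => P)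
            {D : Fin n → X × Z |
              CME.surrogateRisk HX P (fun z => CME.ridgeEstimate HX G kZ (lam n) D z)
                - CME.surrogateRisk HX P FP > ε} < ENNReal.ofReal δ := by
  intro P _ FP hFP ε δ hε hδ
  have hφ := CME.stronglyMeasurable_feature hkX
  have hφ2 : MemLp (fun p : X × Z => CME.feature HX p.1) 2 P :=
    MemLp.of_bound (hφ.comp_measurable measurable_fst).aestronglyMeasurable BX
      (ae_of_all _ fun p => CME.norm_feature_le hBX.le (hkXb p.1))
  have hB : ∀ z : Z, ‖RKHS.kerFun G z‖ ≤ BZ := fun z =>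
    CME.norm_kerFun_le hkZ hG hBZ.le (hkZb z)
  have hmeas : ∀ F : G, StronglyMeasurable fun z : Z => F z := fun F =>
    (huniv.1 F).1.stronglyMeasurable
  obtain ⟨A, hA, hAB⟩ := CME.exists_toL2 P (measurable_snd : Measurable (Prod.snd : X × Z → Z))
    hBZ.le hB hmeas
  set Φ := hφ2.toLp _ with hΦ
  set Ψ := (hFP.memLp hφ2).toLp _ with hΨ
  have hpyth : ∀ F : G, ‖Φ - A F‖ ^ 2 = ‖Φ - Ψ‖ ^ 2 + ‖A F - Ψ‖ ^ 2 := fun F =>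
    hFP.norm_sub_sq hφ2 (hmeas F) (hA F)
  have hexcess : ∀ F : G, CME.surrogateRisk HX P (fun z => F z) - CME.surrogateRisk HX P FP
      = ‖A F - Ψ‖ ^ 2 := fun F => by
    rw [CME.surrogateRisk_eq_norm_sq hφ2 (hA F),
      CME.surrogateRisk_eq_norm_sq hφ2 (hFP.memLp hφ2).coeFn_toLp, ← hΦ, ← hΨ, hpyth]
    ring
  choose u hu using fun n => exists_ridge_solution A Φ (hlam_pos n)
  have happrox := tendsto_ridge_solution hpyth
    (CME.mem_closure_range_toL2 huniv hA hFP.1 (hFP.memLp hφ2)) (fun n => (hlam_pos n).le)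
    hlam_zero hu
  have hrt : 0 < Real.sqrt ε := Real.sqrt_pos.2 hε
  -- Since `‖A F‖ ≤ BZ ‖F‖`, an error below `t` in `G` costs less than `√ε / 2` in `L²`; the bias
  -- takes the other half.
  set t := Real.sqrt ε / (2 * BZ) with ht
  have ht0 : 0 < t := by positivity
  have htail : Tendsto (fun n : ℕ => BZ ^ 2 * ‖Φ‖ ^ 2 / (n * (lam n * t) ^ 2)) atTop (𝓝 0) := by
    refine Tendsto.div_atTop tendsto_const_nhds ?_
    -- The denominator is `(√n lam n)² t²`.
    have h := ((tendsto_pow_atTop two_ne_zero).comp hlam_slow).atTop_mul_const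
      (show 0 < t ^ 2 by positivity)
    refine h.congr fun n => ?_
    simp only [Function.comp_apply, mul_pow, Real.sq_sqrt (Nat.cast_nonneg n)]
    ring
  filter_upwards [happrox.eventually_lt_const (half_pos hrt), htail.eventually_lt_const hδ,
    eventually_gt_atTop 0] with n hn1 hn2 hn3
  refine lt_of_le_of_lt ?_ ((ENNReal.ofReal_lt_ofReal_iff hδ).2 hn2)
  refine (measure_mono fun D hD => ?_).trans
    (CME.measure_ridgeEstimate_sub_ge_le hkZ hG hB hφ hφ2 hmeas hA (hlam_pos n) (hu n)
      hn3 ht0)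
  have hD' : ε < ‖A (CME.ridgeEstimate HX G kZ (lam n) D) - Ψ‖ ^ 2 := by
    rw [← hexcess]
    exact hD
  have h1 : Real.sqrt ε < ‖A (CME.ridgeEstimate HX G kZ (lam n) D) - Ψ‖ :=
    (Real.sqrt_lt' (by
      by_contra h
      have : ‖A (CME.ridgeEstimate HX G kZ (lam n) D) - Ψ‖ = 0 :=
        le_antisymm (not_lt.1 h) (norm_nonneg _)
      rw [this] at hD'
      linarith)).2 hD'
  -- With total error above `√ε` and bias below `√ε / 2`, the estimation error in `L²` exceeds `√ε /
  -- 2`, hence is at least `t` in `G`.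
  have h2 := norm_sub_le_norm_sub_add_norm_sub (A (CME.ridgeEstimate HX G kZ (lam n) D))
    (A (u n)) Ψ
  have h3 := hAB (CME.ridgeEstimate HX G kZ (lam n) D - u n)
  rw [map_sub] at h3
  change t ≤ _
  rw [ht, div_le_iff₀ (by positivity)]
  linarith
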